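/- Let $A$ be an idiom, i.e. a complete, modular, upper continuous lattice, with least element $0$ and greatest element $1$. For $a\le b$ let $[a,b]$ denote the corresponding interval; an element $x$ with $a\le x\le b$ is essential in $[a,b]$ if $x\wedge y=a$ implies $y=a$ for all $a\le y\le b$. Two intervals are similar, $I\sim J$, if for some $l,r\in A$ one of them is $[l,l\vee r]$ and the other is $[l\wedge r,r]$. A nucleus on $A$ is an inflationary idempotent map $j\colon A\to A$ preserving binary meets; nuclei are ordered pointwise. Let $\chi(a,b)$ be the largest nucleus $j$ with $j(a)\wedge b=a$, and put $D_j=\{[a,b]\mid b\le j(a)\}$ and $F_j=\{[a,b]\mid j\le\chi(a,b)\}$. An interval $[a,b]$ is nonsingular if $[c,d]\sim[a,x]$ with $a\le x\le b$ and $c$ essential in $[0,d]$ implies $c=d$; $\mathfrak G(A)$ is the set of nonsingular intervals. The Goldie nucleus of $A$ is $\zeta=\bigwedge\{\chi(a,1)\mid [a,1]\in\mathfrak G(A)\}$; if there is a nucleus $j$ with $F_j=\mathfrak G(A)$, then $j=\zeta$. Let $R$ be an associative ring with unit. For a left $R$-module $M$ let $\Lambda(M)$ be the idiom of submodules of $M$,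 and let $Z(M)$ be the submodule of all $m\in M$ whose annihilator $\{r\in R\mid rm=0\}$ is an essential left ideal. The module $M$ is nonsingular if $Z(M)=0$, and singular (in the Goldie sense) if $Z(M)$ is essential in $M$; $R$ is nonsingular if it is nonsingular as a left $R$-module. Let $\mathcal T_g$ be the class of all singular left $R$-modules, and let $\langle M\rangle(\mathcal T_g)$ be the set of intervals $[N,L]$ of $\Lambda(M)$ with $L/N\in\mathcal T_g$. **Proposition.** (1) $R$ is nonsingular if and only if $\langle R\rangle(\mathcal T_g)=D_\zeta$, where $\zeta$ is the Goldie nucleus of $\Lambda(R)$. Moreover, if $R$ is nonsingular, then $F_\zeta=\mathfrak G(\Lambda(R))$. (2) Suppose that $R$ is nonsingular. Then a left $R$-module $M$ is nonsingular if and only if $\langle M\rangle(\mathcal T_g)=D_\zeta$, where $\zeta$ is the Goldie nucleus of $\Lambda(M)$. Moreover, if $M$ is nonsingular, then $F_\zeta=\mathfrak G(\Lambda(M))$. -/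

import Mathlib

universe u v

namespace PointFree

section Idioms

/-- An idiom: a complete lattice that is modular and upper continuous. -/
class IsIdiom (A : Type u) [CompleteLattice A] : Prop extends IsModularLattice A where
  inf_sSup_eq_of_directedOn : ∀ (a : A) (X : Set A), DirectedOn (· ≤ ·) X →
    a ⊓ sSup X = ⨆ x ∈ X, a ⊓ x

/-- The lattice `Λ(M)` of submodules of a module is an idiom. -/
instance instIsIdiomSubmodule (R : Type u) (M : Type v) [Ring R] [AddCommGroup M] [Module R M] :
    IsIdiom (Submodule R M) where
  inf_sSup_eq_of_directedOn _ _ h := h.inf_sSup_eq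

variable {A : Type u} [CompleteLattice A]

/-- The element `x` lies in the interval `[a, b]` and is essential in it. -/
def EssentialIn (x a b : A) : Prop :=
  a ≤ x ∧ x ≤ b ∧ ∀ y, a ≤ y → y ≤ b → x ⊓ y = a → y = a

/-- Similarity `I ∼ J` of intervals: for some `l`, `r`, one of them is `[l, l ⊔ r]` and the other
one is `[l ⊓ r, r]`. (This relation is reflexive and symmetric; it is not made transitive.) -/
def Similar (I J : NonemptyInterval A) : Prop :=
  ∃ l r : A,
    ((I.fst = l ∧ I.snd = l ⊔ r) ∧ (J.fst = l ⊓ r ∧ J.snd = r)) ∨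
    ((J.fst = l ∧ J.snd = l ⊔ r) ∧ (I.fst = l ⊓ r ∧ I.snd = r))

/-- The set `D_j` of the intervals `[a, b]` with `b ≤ j a`. -/
def divisionSet (j : Nucleus A) : Set (NonemptyInterval A) :=
  {I | I.snd ≤ j I.fst}

/-- The nucleus `χ(a, b)`: the largest nucleus `j` with `j a ⊓ b = a`
(see `chi_isGreatest`). -/
noncomputable def chi (a b : A) : Nucleus A :=
  sSup {j : Nucleus A | j a ⊓ b = a}

/-- The set `F_j` of the intervals `[a, b]` with `j ≤ χ(a, b)`. -/
def freeSet (j : Nucleus A) : Set (NonemptyInterval A) :=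
  {I | j ≤ chi I.fst I.snd}

variable (A) in
/-- The set `𝔊(A)` of all nonsingular intervals: `[a, b]` is nonsingular if, whenever `[c, d]` is
similar to `[a, x]` for some `a ≤ x ≤ b` and `c` is essential in `[0, d]`, then `c = d`. -/
def nonsingularIntervals : Set (NonemptyInterval A) :=
  {I | ∀ J K : NonemptyInterval A, K.fst = I.fst → K.snd ≤ I.snd → Similar J K →
    EssentialIn J.fst ⊥ J.snd → J.fst = J.snd}

variable (A) in
/-- The Goldie nucleus `ζ = ⋀ {χ(a, 1) ∣ [a, 1] nonsingular}`. In an idiom it is the nucleus `j`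
with `F_j = 𝔊(A)` as soon as there is such a nucleus (see `eq_goldieNucleus`). -/
noncomputable def goldieNucleus : Nucleus A :=
  sInf {j : Nucleus A | ∃ I ∈ nonsingularIntervals A, I.snd = ⊤ ∧ j = chi I.fst ⊤}

theorem inf_iSup_of_directed [IsIdiom A] {ι : Type v} (a : A) (f : ι → A)
    (hf : Directed (· ≤ ·) f) : a ⊓ ⨆ i, f i = ⨆ i, a ⊓ f i := by
  have h := IsIdiom.inf_sSup_eq_of_directedOn a (Set.range f) hf.directedOn_range
  rwa [sSup_range, iSup_range] at h

/-- In an idiom there is a largest nucleus `j` with `j a ⊓ b = a`, for all `a ≤ b`. -/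
theorem chi_isGreatest [IsIdiom A] {a b : A} (hab : a ≤ b) :
    IsGreatest {j : Nucleus A | j a ⊓ b = a} (chi a b) := by
  let P : Type u := {f : InfHom A A // (∀ x, x ≤ f x) ∧ f a ⊓ b = a}
  have hmono : ∀ f : P, Monotone f.1 := fun f => OrderHomClass.mono f.1
  let comp : P → P → P := fun f g => ⟨f.1.comp g.1,
    fun x => (g.2.1 x).trans (f.2.1 _), by
      have h1 : f.1 (g.1 a) ⊓ f.1 b = f.1 a := by rw [← map_inf, g.2.2]
      have h2 : f.1 (g.1 a) ⊓ b = f.1 (g.1 a) ⊓ f.1 b ⊓ b := by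
        rw [inf_assoc, inf_eq_right.2 (f.2.1 b)]
      change f.1 (g.1 a) ⊓ b = a
      rw [h2, h1, f.2.2]⟩
  have hl : ∀ (f g : P) x, f.1 x ≤ (comp f g).1 x := fun f g x => hmono f (g.2.1 x)
  have hr : ∀ (f g : P) x, g.1 x ≤ (comp f g).1 x := fun f g x => f.2.1 _
  have hdir : ∀ x, Directed (· ≤ ·) (fun f : P => f.1 x) :=
    fun x f g => ⟨comp f g, hl f g x, hr f g x⟩
  let h : A → A := fun x => ⨆ f : P, f.1 x
  have hle : ∀ (f : P) x, f.1 x ≤ h x := fun f x => le_iSup (fun f : P => f.1 x) f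
  have hhmono : Monotone h := fun x y hxy => iSup_mono fun f => hmono f hxy
  have hinf : ∀ x y, h (x ⊓ y) = h x ⊓ h y := by
    intro x y
    refine le_antisymm (le_inf (hhmono inf_le_left) (hhmono inf_le_right)) ?_
    change h x ⊓ (⨆ g : P, g.1 y) ≤ _
    rw [inf_iSup_of_directed _ _ (hdir y)]
    refine iSup_le fun g => ?_
    rw [inf_comm]
    change g.1 y ⊓ (⨆ f : P, f.1 x) ≤ _
    rw [inf_iSup_of_directed _ _ (hdir x)]
    refine iSup_le fun f => ?_
    calc g.1 y ⊓ f.1 x ≤ (comp f g).1 y ⊓ (comp f g).1 x := inf_le_inf (hr f g y) (hl f g x)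
      _ = (comp f g).1 (x ⊓ y) := by rw [map_inf, inf_comm]
      _ ≤ _ := hle _ _
  let idP : P := ⟨⟨id, fun _ _ => rfl⟩, fun _ => le_rfl, inf_eq_left.2 hab⟩
  have hinfl : ∀ x, x ≤ h x := fun x => hle idP x
  have hhab : h a ⊓ b = a := by
    rw [inf_comm]
    change b ⊓ (⨆ f : P, f.1 a) = a
    rw [inf_iSup_of_directed _ _ (hdir a)]
    refine le_antisymm (iSup_le fun f => ?_) ?_
    · rw [inf_comm, f.2.2]
    · exact (le_inf hab le_rfl).trans (le_iSup (fun f : P => b ⊓ f.1 a) idP)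
  let hP : P := ⟨⟨h, hinf⟩, hinfl, hhab⟩
  let k : Nucleus A := ⟨⟨h, hinf⟩, fun x => hle (comp hP hP) x, hinfl⟩
  have hk : IsGreatest {j : Nucleus A | j a ⊓ b = a} k :=
    ⟨hhab, fun j hj x => hle ⟨j.toInfHom, fun y => j.le_apply' y, hj⟩ x⟩
  have : chi a b = k := hk.isLUB.sSup_eq
  rw [this]
  exact hk

/-- In an idiom, the only nucleus `j` with `F_j = 𝔊(A)`, if there is one, is the Goldie nucleus. -/
theorem eq_goldieNucleus [IsIdiom A] (j : Nucleus A) (hj : freeSet j = nonsingularIntervals A) :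
    j = goldieNucleus A := by
  refine le_antisymm (le_sInf ?_) fun x => ?_
  · rintro _ ⟨I, hI, hI1, rfl⟩
    rw [← hj] at hI
    rw [← hI1]
    exact hI
  · have hfix : j (j x) ⊓ ⊤ = j x := by rw [inf_top_eq, j.idempotent]
    have hmem : (⟨⟨j x, ⊤⟩, le_top⟩ : NonemptyInterval A) ∈ nonsingularIntervals A := by
      rw [← hj]
      exact (chi_isGreatest le_top).2 hfix
    have h1 : goldieNucleus A ≤ chi (j x) ⊤ := sInf_le ⟨_, hmem, rfl, rfl⟩
    have h2 : chi (j x) ⊤ (j x) = j x := by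
      have := (chi_isGreatest (le_top : j x ≤ ⊤)).1
      rwa [Set.mem_ofPred_eq, inf_top_eq] at this
    calc goldieNucleus A x ≤ goldieNucleus A (j x) := (goldieNucleus A).monotone j.le_apply
      _ ≤ chi (j x) ⊤ (j x) := h1 _
      _ = j x := h2

end Idioms

section Modules

variable (R : Type u) [Ring R]

/-- The left ideal `(0 : m) = {r ∣ r m = 0}`. -/
def annih {M : Type v} [AddCommGroup M] [Module R M] (m : M) : Submodule R R :=
  LinearMap.ker (LinearMap.toSpanSingleton R M m)

theorem mem_annih {M : Type v} [AddCommGroup M] [Module R M] {m : M} {r : R} :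
    r ∈ annih R m ↔ r • m = 0 := by
  simp [annih]

/-- The singular submodule `Z(M)`: all `m` for which `(0 : m)` is an essential left ideal. -/
def singularSubmodule (M : Type v) [AddCommGroup M] [Module R M] : Submodule R M where
  carrier := {m | EssentialIn (annih R m) ⊥ ⊤}
  zero_mem' := by
    refine ⟨bot_le, le_top, fun J _ _ hJ => ?_⟩
    have : annih R (0 : M) = ⊤ := by ext; simp [mem_annih]
    rwa [this, top_inf_eq] at hJ
  add_mem' := by
    rintro m n ⟨-, -, hm⟩ ⟨-, -, hn⟩
    refine ⟨bot_le, le_top, fun J _ _ hJ => hn J bot_le le_top ?_⟩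
    refine hm _ bot_le le_top (le_bot_iff.1 (le_trans ?_ hJ.le))
    rintro r ⟨h1, h2, h3⟩
    refine ⟨?_, h3⟩
    simp only [SetLike.mem_coe, mem_annih] at h1 h2 ⊢
    rw [smul_add, h1, h2, add_zero]
  smul_mem' := by
    rintro r m ⟨-, -, hm⟩
    refine ⟨bot_le, le_top, fun J _ _ hJ => ?_⟩
    have h1 : J.map (LinearMap.toSpanSingleton R R r) = ⊥ := by
      refine hm _ bot_le le_top (le_bot_iff.1 ?_)
      rintro _ ⟨h1, s, hs, rfl⟩
      simp only [SetLike.mem_coe, mem_annih, LinearMap.toSpanSingleton_apply, smul_eq_mul,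
        mul_smul] at h1
      have : s ∈ annih R (r • m) ⊓ J := ⟨(mem_annih R).2 h1, hs⟩
      rw [hJ, Submodule.mem_bot] at this
      simp [this]
    have h3 : J ≤ annih R (r • m) := by
      intro s hs
      have h2 : LinearMap.toSpanSingleton R R r s ∈ J.map (LinearMap.toSpanSingleton R R r) :=
        ⟨s, hs, rfl⟩
      rw [h1, Submodule.mem_bot, LinearMap.toSpanSingleton_apply, smul_eq_mul] at h2
      rw [mem_annih, ← mul_smul, h2, zero_smul]
    rwa [inf_eq_right.2 h3] at hJ

/-- A module is singular if its singular submodule is essential in it. The singular modules form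
the Goldie torsion class `T_g`. -/
def IsSingularModule (M : Type v) [AddCommGroup M] [Module R M] : Prop :=
  EssentialIn (singularSubmodule R M) ⊥ ⊤

/-- A module is nonsingular if its singular submodule is zero. -/
def IsNonsingularModule (M : Type v) [AddCommGroup M] [Module R M] : Prop :=
  singularSubmodule R M = ⊥

/-- A ring is (left) nonsingular if it is nonsingular as a left module over itself. -/
def IsNonsingularRing : Prop :=
  IsNonsingularModule R R

/-- The slice `⟨M⟩(T)` of a class `T` of modules: the intervals `[N, L]` of the lattice of
submodules of `M` whose factor `L / N` belongs to `T`. -/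
def slice (M : Type v) [AddCommGroup M] [Module R M]
    (T : ∀ (X : Type v) [AddCommGroup X] [Module R X], Prop) :
    Set (NonemptyInterval (Submodule R M)) :=
  {I | T (I.snd ⧸ I.fst.submoduleOf I.snd)}

end Modules

end PointFree

/-! Over a nonsingular ring, `N ↦` the preimage of `Z(M / N)` is a nucleus `j`, because `M / Z(M)`
is nonsingular; for the same reason Goldie singular means `Z = ⊤`, so the slice is `D_j` for every
`M`. If `M` is also nonsingular, `L ≤ j N` means that `N` is essential in `L`
(`le_singularNucleus_iff`). A purely lattice-theoretic argument then gives `F_j = 𝔊`, and uniqueness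
forces `j = ζ`. The converse holds over any ring: `[0, Z(M)]` lies in the slice, while `ζ 0 = 0`
since `[0, 1]` is nonsingular. -/

namespace PointFree

/-! ### Nonsingular intervals and essential elements in idioms -/

section Intervals

variable {A : Type u} [CompleteLattice A]

/-- The interval `[⊥, ⊤]` is always nonsingular. -/
theorem bot_top_mem_nonsingularIntervals :
    (⟨⟨⊥, ⊤⟩, bot_le⟩ : NonemptyInterval A) ∈ nonsingularIntervals A := by
  rintro J K hK - ⟨l, r, ⟨⟨h1, h2⟩, h3, h4⟩ | ⟨⟨h1, h2⟩, h3, h4⟩⟩ ⟨-, -, he⟩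
  · have hr : r = ⊥ := he r bot_le (by rw [h2]; exact le_sup_right) (by rw [h1, ← h3, hK])
    rw [h1, h2, hr, sup_bot_eq]
  · have hl : l = ⊥ := h1.symm.trans hK
    have hJ : J.fst = ⊥ := by rw [h3, hl, bot_inf_eq]
    rw [hJ]
    exact (he J.snd bot_le le_rfl (by rw [hJ, bot_inf_eq])).symm

theorem goldieNucleus_bot [IsIdiom A] : goldieNucleus A ⊥ = ⊥ := by
  have h1 : goldieNucleus A ≤ chi ⊥ ⊤ := sInf_le ⟨_, bot_top_mem_nonsingularIntervals, rfl, rfl⟩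
  have h2 := (chi_isGreatest (bot_le : (⊥ : A) ≤ ⊤)).1
  rw [Set.mem_ofPred_eq, inf_top_eq] at h2
  exact le_bot_iff.1 ((h1 ⊥).trans h2.le)

theorem le_chi_iff [IsIdiom A] {a b : A} (hab : a ≤ b) (j : Nucleus A) :
    j ≤ chi a b ↔ j a ⊓ b = a := by
  refine ⟨fun h => le_antisymm ?_ (le_inf j.le_apply hab), fun h => (chi_isGreatest hab).2 h⟩
  exact (inf_le_inf_right b (h a)).trans (chi_isGreatest hab).1.le

/-- If `D_j` consists of the intervals `[a, b]` with `a` essential in `[⊥, b]`, then `F_j` is the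
set of all nonsingular intervals. -/
theorem freeSet_eq_nonsingularIntervals [IsIdiom A] (j : Nucleus A)
    (hj : ∀ a b : A, a ≤ b → (b ≤ j a ↔ EssentialIn a ⊥ b)) :
    freeSet j = nonsingularIntervals A := by
  ext ⟨⟨a, b⟩, hab⟩
  change j ≤ chi a b ↔ _
  rw [le_chi_iff hab]
  constructor
  · rintro h ⟨⟨c, d⟩, hcd⟩ ⟨⟨a', x⟩, hax⟩ hK hxb hs he
    change c = d
    obtain rfl : a' = a := hK
    change x ≤ b at hxb
    have hd : d ≤ j c := (hj c d hcd).2 he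
    obtain ⟨l, r, ⟨⟨h1, h2⟩, h3, h4⟩ | ⟨⟨h1, h2⟩, h3, h4⟩⟩ := hs
    · dsimp only at h1 h2 h3 h4
      subst h1 h4
      -- Here `a' = c ⊓ x`. As `x ≤ d ≤ j c` and `x ≤ j x`, also `x ≤ j a'`; freeness then gives `x
      -- ≤ a' ≤ c`.
      have hx : x ≤ j a' := by
        rw [h3, map_inf]
        exact le_inf ((le_sup_right.trans h2.ge).trans hd) j.le_apply
      have hxc : x ≤ c := ((le_inf hx hxb).trans h.le).trans (h3.le.trans inf_le_left)
      rw [h2, sup_eq_left.2 hxc]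
    · dsimp only at h1 h2 h3 h4
      subst h1 h4
      have hda : d ≤ j a' := hd.trans (j.monotone (h3.le.trans inf_le_left))
      have hdb : d ≤ b := (le_sup_right.trans h2.ge).trans hxb
      rw [h3, inf_eq_right.2 ((le_inf hda hdb).trans h.le)]
  · intro h
    have hax : a ≤ j a ⊓ b := le_inf j.le_apply hab
    -- `[a, j a ⊓ b]` lies in `D_j`, so `a` is essential below its top; being similar to itself, it
    -- must collapse.
    exact (h ⟨⟨a, j a ⊓ b⟩, hax⟩ ⟨⟨a, j a ⊓ b⟩, hax⟩ rfl inf_le_right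
      ⟨a, j a ⊓ b, Or.inl ⟨⟨rfl, (sup_eq_right.2 hax).symm⟩, (inf_eq_left.2 hax).symm, rfl⟩⟩
      ((hj _ _ hax).1 inf_le_left)).symm

theorem EssentialIn.mono {x y : A} (h : EssentialIn x ⊥ ⊤) (hxy : x ≤ y) : EssentialIn y ⊥ ⊤ :=
  ⟨bot_le, le_top, fun z _ _ hz => h.2.2 z bot_le le_top
    (le_bot_iff.1 ((inf_le_inf_right z hxy).trans hz.le))⟩

theorem EssentialIn.inf {x y : A} (hx : EssentialIn x ⊥ ⊤) (hy : EssentialIn y ⊥ ⊤) :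
    EssentialIn (x ⊓ y) ⊥ ⊤ :=
  ⟨bot_le, le_top, fun z _ _ hz => hy.2.2 z bot_le le_top
    (hx.2.2 _ bot_le le_top (by rw [← inf_assoc, hz]))⟩

theorem essentialIn_top : EssentialIn (⊤ : A) ⊥ ⊤ :=
  ⟨bot_le, le_top, fun _ _ _ hz => by rwa [top_inf_eq] at hz⟩

end Intervals

/-! ### The singular submodule and its nucleus -/

section Modules

variable {R : Type u} [Ring R] {M : Type v} [AddCommGroup M] [Module R M]

theorem mem_singularSubmodule {m : M} :
    m ∈ singularSubmodule R M ↔ EssentialIn (annih R m) ⊥ ⊤ :=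
  Iff.rfl

/-- An essential submodule has essential residuals. -/
theorem EssentialIn.comap_toSpanSingleton {N L : Submodule R M} (h : EssentialIn N ⊥ L) {m : M}
    (hm : m ∈ L) : EssentialIn (N.comap (LinearMap.toSpanSingleton R M m)) ⊥ ⊤ := by
  refine ⟨bot_le, le_top, fun J _ _ hJ => ?_⟩
  -- If `J` misses the residual `(N : m)`, then `J m` misses `N`, so `J m = 0` and `J ≤ (N : m)`.
  have h1 : J.map (LinearMap.toSpanSingleton R M m) = ⊥ := by
    refine h.2.2 _ bot_le ?_ (le_bot_iff.1 ?_)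
    · rintro _ ⟨s, -, rfl⟩
      exact L.smul_mem s hm
    · rintro _ ⟨h1, s, hs, rfl⟩
      have : s ∈ N.comap (LinearMap.toSpanSingleton R M m) ⊓ J := ⟨h1, hs⟩
      rw [hJ, Submodule.mem_bot] at this
      simp [this]
  have h2 : J ≤ N.comap (LinearMap.toSpanSingleton R M m) := by
    intro s hs
    have h3 : LinearMap.toSpanSingleton R M m s ∈ J.map (LinearMap.toSpanSingleton R M m) :=
      ⟨s, hs, rfl⟩
    rw [h1, Submodule.mem_bot] at h3
    rw [Submodule.mem_comap, h3]
    exact N.zero_mem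
  rwa [inf_eq_right.2 h2] at hJ

/-- Over a nonsingular ring, `M / Z(M)` is nonsingular. -/
theorem mem_singularSubmodule_of_essentialIn_comap (hR : IsNonsingularRing R) {m : M}
    (hm : EssentialIn ((singularSubmodule R M).comap (LinearMap.toSpanSingleton R M m)) ⊥ ⊤) :
    m ∈ singularSubmodule R M := by
  refine ⟨bot_le, le_top, fun J _ _ hJ => ?_⟩
  refine hm.2.2 J bot_le le_top (le_bot_iff.1 ?_)
  rintro s ⟨hs, hsJ⟩
  have hs' : EssentialIn (annih R (s • m)) ⊥ ⊤ := hs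
  rw [← show singularSubmodule R R = ⊥ from hR]
  -- Since `J` misses `(0 : m)`, whatever kills `s m` kills `s`; hence `s ∈ Z(R) = 0`.
  refine hs'.mono fun r hr => ?_
  rw [mem_annih, ← mul_smul] at hr
  have : r * s ∈ annih R m ⊓ J := ⟨(mem_annih R).2 hr, J.smul_mem r hsJ⟩
  rw [hJ, Submodule.mem_bot] at this
  rwa [mem_annih, smul_eq_mul]

theorem isSingularModule_iff_eq_top (hR : IsNonsingularRing R) :
    IsSingularModule R M ↔ singularSubmodule R M = ⊤ := by
  refine ⟨fun h => eq_top_iff.2 fun m _ => ?_, fun h => ?_⟩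
  · exact mem_singularSubmodule_of_essentialIn_comap hR (h.comap_toSpanSingleton trivial)
  · rw [IsSingularModule, h]
    exact essentialIn_top

theorem annih_mkQ (N : Submodule R M) (m : M) :
    annih R (N.mkQ m) = N.comap (LinearMap.toSpanSingleton R M m) := by
  ext r
  rw [mem_annih, ← map_smul, Submodule.mkQ_apply, Submodule.Quotient.mk_eq_zero]
  rfl

variable (R M) in
/-- Over a nonsingular ring, the nucleus sending `N` to the preimage of `Z(M / N)` in `M`. -/
def singularNucleus (hR : IsNonsingularRing R) : Nucleus (Submodule R M) where
  toFun N := (singularSubmodule R (M ⧸ N)).comap N.mkQ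
  map_inf' N L := by
    ext m
    simp only [Submodule.mem_inf, Submodule.mem_comap, mem_singularSubmodule, annih_mkQ,
      Submodule.comap_inf]
    exact ⟨fun h => ⟨h.mono inf_le_left, h.mono inf_le_right⟩, fun h => h.1.inf h.2⟩
  idempotent' N m hm := by
    -- This is nonsingularity of `X / Z(X)` for `X = M / N`.
    refine mem_singularSubmodule_of_essentialIn_comap hR (EssentialIn.mono hm fun r hr => ?_)
    rw [mem_annih, ← map_smul, Submodule.mkQ_apply, Submodule.Quotient.mk_eq_zero] at hr
    exact hr
  le_apply' N m hm := by
    have : N.mkQ m = 0 := (Submodule.Quotient.mk_eq_zero N).2 hm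
    rw [Submodule.mem_comap, this]
    exact Submodule.zero_mem _

theorem mem_singularNucleus (hR : IsNonsingularRing R) {N : Submodule R M} {m : M} :
    m ∈ singularNucleus R M hR N ↔
      EssentialIn (N.comap (LinearMap.toSpanSingleton R M m)) ⊥ ⊤ := by
  rw [← annih_mkQ]
  rfl

/-- The annihilator of a class in `L / N` is the residual `(N : m)` computed in `M`, so singularity
of `L / N` can be tested inside `M`. -/
theorem mem_slice_singular_iff (hR : IsNonsingularRing R)
    (I : NonemptyInterval (Submodule R M)) :
    I ∈ slice R M (fun X _ _ => IsSingularModule R X) ↔ I.snd ≤ singularNucleus R M hR I.fst := by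
  have hannih : ∀ m : I.snd, annih R ((I.fst.submoduleOf I.snd).mkQ m) =
      I.fst.comap (LinearMap.toSpanSingleton R M (m : M)) := fun m => by
    ext r
    rw [mem_annih, ← map_smul, Submodule.mkQ_apply, Submodule.Quotient.mk_eq_zero]
    rfl
  change IsSingularModule R (I.snd ⧸ I.fst.submoduleOf I.snd) ↔ _
  rw [isSingularModule_iff_eq_top hR]
  constructor
  · intro h m hm
    have : (I.fst.submoduleOf I.snd).mkQ ⟨m, hm⟩ ∈
        singularSubmodule R (I.snd ⧸ I.fst.submoduleOf I.snd) := h ▸ trivial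
    rwa [mem_singularSubmodule, hannih, ← mem_singularNucleus hR] at this
  · refine fun h => eq_top_iff.2 fun x _ => ?_
    obtain ⟨m, rfl⟩ := Submodule.mkQ_surjective _ x
    rw [mem_singularSubmodule, hannih, ← mem_singularNucleus hR]
    exact h m.2

/-- If `P ≤ L` misses `N`, then for `m ∈ P` the essential residual `(N : m)` kills `m`, so `m ∈ Z(M)
= 0`. -/
theorem le_singularNucleus_iff (hR : IsNonsingularRing R) (hM : IsNonsingularModule R M)
    (N L : Submodule R M) (hNL : N ≤ L) :
    L ≤ singularNucleus R M hR N ↔ EssentialIn N ⊥ L := by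
  refine ⟨fun h => ⟨bot_le, hNL, fun P _ hPL hP => le_bot_iff.1 fun m hm => ?_⟩, fun h m hm =>
    (mem_singularNucleus hR).2 (h.comap_toSpanSingleton hm)⟩
  rw [← show singularSubmodule R M = ⊥ from hM]
  refine ((mem_singularNucleus hR).1 (h (hPL hm))).mono fun r hr => ?_
  have : r • m ∈ N ⊓ P := ⟨hr, P.smul_mem r hm⟩
  rwa [hP, Submodule.mem_bot, ← mem_annih] at this

theorem singularNucleus_eq_goldieNucleus (hR : IsNonsingularRing R)
    (hM : IsNonsingularModule R M) : singularNucleus R M hR = goldieNucleus (Submodule R M) :=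
  eq_goldieNucleus _ (freeSet_eq_nonsingularIntervals _ (le_singularNucleus_iff hR hM))

theorem freeSet_goldieNucleus (hR : IsNonsingularRing R) (hM : IsNonsingularModule R M) :
    freeSet (goldieNucleus (Submodule R M)) = nonsingularIntervals (Submodule R M) := by
  rw [← singularNucleus_eq_goldieNucleus hR hM]
  exact freeSet_eq_nonsingularIntervals _ (le_singularNucleus_iff hR hM)

theorem slice_singular_eq_divisionSet (hR : IsNonsingularRing R) (hM : IsNonsingularModule R M) :
    slice R M (fun X _ _ => IsSingularModule R X) =
      divisionSet (goldieNucleus (Submodule R M)) := by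
  rw [← singularNucleus_eq_goldieNucleus hR hM]
  exact Set.ext (mem_slice_singular_iff hR)

variable (R M) in
/-- The interval `[0, Z(M)]` always belongs to the slice of the singular modules. -/
theorem bot_singularSubmodule_mem_slice :
    (⟨⟨⊥, singularSubmodule R M⟩, bot_le⟩ : NonemptyInterval (Submodule R M)) ∈
      slice R M (fun X _ _ => IsSingularModule R X) := by
  change EssentialIn (singularSubmodule R
    (singularSubmodule R M ⧸ (⊥ : Submodule R M).submoduleOf (singularSubmodule R M))) ⊥ ⊤
  refine essentialIn_top.mono fun x _ => ?_
  obtain ⟨m, rfl⟩ := Submodule.mkQ_surjective _ x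
  refine EssentialIn.mono m.2 fun r hr => ?_
  have hrm : r • m = 0 := Subtype.ext ((mem_annih R).1 hr)
  rw [mem_annih, ← map_smul, hrm, map_zero]

theorem isNonsingularModule_of_slice_eq
    (h : slice R M (fun X _ _ => IsSingularModule R X) =
      divisionSet (goldieNucleus (Submodule R M))) : IsNonsingularModule R M := by
  have h1 := bot_singularSubmodule_mem_slice R M
  rw [h] at h1
  have h2 : singularSubmodule R M ≤ goldieNucleus (Submodule R M) ⊥ := h1
  rw [goldieNucleus_bot] at h2
  exact le_bot_iff.1 h2

end Modules

end PointFree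

theorem mainTheorem11 (R : Type u) [Ring R] :
    ((PointFree.IsNonsingularRing R ↔
        PointFree.slice R R (fun X _ _ => PointFree.IsSingularModule R X) =
          PointFree.divisionSet (PointFree.goldieNucleus (Submodule R R))) ∧
      (PointFree.IsNonsingularRing R →
        PointFree.freeSet (PointFree.goldieNucleus (Submodule R R)) =
          PointFree.nonsingularIntervals (Submodule R R))) ∧
    (PointFree.IsNonsingularRing R →
      ∀ (M : Type v) [AddCommGroup M] [Module R M],
        (PointFree.IsNonsingularModule R M ↔
          PointFree.slice R M (fun X _ _ => PointFree.IsSingularModule R X) =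
            PointFree.divisionSet (PointFree.goldieNucleus (Submodule R M))) ∧
        (PointFree.IsNonsingularModule R M →
          PointFree.freeSet (PointFree.goldieNucleus (Submodule R M)) =
            PointFree.nonsingularIntervals (Submodule R M))) :=
  ⟨⟨⟨fun hR => PointFree.slice_singular_eq_divisionSet hR hR,
      PointFree.isNonsingularModule_of_slice_eq⟩,
    fun hR => PointFree.freeSet_goldieNucleus hR hR⟩,
  fun hR _ _ _ => ⟨⟨PointFree.slice_singular_eq_divisionSet hR,
    PointFree.isNonsingularModule_of_slice_eq⟩, PointFree.freeSet_goldieNucleus hR⟩⟩
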